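/- A $(\Gamma,\Lambda,\ell)$-consistent hashing of $\mathbb{R}^d$ is a random function $\varphi:\mathbb{R}^d\to\mathbb{R}^d$ such that for every $x\in\mathbb{R}^d$ one always has $\operatorname{diam}(\varphi^{-1}(x))\le \ell$, and $\mathbb{E}\big[|\varphi(B(x,\ell/\Gamma))|\big]\le\Lambda$, where $B(x,r)$ denotes the closed Euclidean ball of radius $r$ around $x$. Lemma. There exist a polynomial $p$ and a constant $K$ such that for every integer $d\ge 1$, every real $\beta\ge\sqrt{2\pi}$ and every real $\ell>0$, the randomly shifted grid $$\varphi_v(x)=\Big(\Big\lfloor \tfrac{\sqrt d}{\ell}\,x_i+v_i\Big\rfloor\Big)_{i=1}^d ,\qquad v \text{ uniformly distributed on } [0,1]^d,$$ is a $(\beta,t_\beta,\ell)$-consistent hashing of $\mathbb{R}^d$ with $t_\beta=p(d)\cdot\exp\big(K\, d/\beta^{2/3}\big)$. Moreover it can be computed in $O(d)$ time: there are a constant $C$ and a single program for the real RAM (with unit-cost arithmetic, square root, floor, comparisons, and indirect addressing) that, for all $d\ge1$ and $\ell>0$, given $d$, $\ell$, the shift $v$ and a point $x\in\mathbb{R}^d$,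 outputs $\varphi_v(x)$ after at most $C\,d$ steps. The polynomial $p$, the constants $K, C$ and the program depend on none of $d,\beta,\ell,v,x$. -/

import Mathlib

open MeasureTheory
open scoped ENNReal

/-- A `(Γ, Λ, ℓ)`-consistent hashing of `ℝ^d`: a random function `φ ω : ℝ^d → ℝ^d`, where `ω` is
drawn from the probability measure `P`, such that every preimage `(φ ω)⁻¹(x)` has diameter at most
`ℓ`, and for every `x` the expected number of values that `φ ω` takes on the closed ball
`B(x, ℓ / Γ)` is at most `Λ`. The diameter is the extended one, so an unbounded preimage has
diameter `∞`, and an infinite image counts as `∞`. -/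
structure IsConsistentHashing {Ω : Type*} [MeasurableSpace Ω] {d : ℕ} (Γ Λ ℓ : ℝ) (P : Measure Ω)
    (φ : Ω → EuclideanSpace ℝ (Fin d) → EuclideanSpace ℝ (Fin d)) : Prop where
  isProbabilityMeasure : IsProbabilityMeasure P
  measurable_eval : ∀ x, Measurable fun ω => φ ω x
  diameter : ∀ ω x, Metric.ediam (φ ω ⁻¹' {x}) ≤ ENNReal.ofReal ℓ
  aemeasurable_card :
    ∀ x, AEMeasurable (fun ω => ((φ ω '' Metric.closedBall x (ℓ / Γ)).encard : ℝ≥0∞)) P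
  consistency :
    ∀ x, ∫⁻ ω, ((φ ω '' Metric.closedBall x (ℓ / Γ)).encard : ℝ≥0∞) ∂P ≤ ENNReal.ofReal Λ

/-- The uniform distribution on the unit cube `[0,1]^d`. -/
noncomputable def uniformCube (d : ℕ) : Measure (Fin d → ℝ) :=
  volume.restrict (Set.Icc 0 1)

/-- The grid hash with shift vector `v`: the grid has cells of side length `ℓ / √d`, and a point is
mapped to the integer coordinates of its cell, `x ↦ ⌊(√d / ℓ) x + v⌋` (coordinatewise). -/
noncomputable def gridHash (d : ℕ) (ℓ : ℝ) (v : Fin d → ℝ) (x : EuclideanSpace ℝ (Fin d)) :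
    EuclideanSpace ℝ (Fin d) :=
  WithLp.toLp 2 fun i => (⌊Real.sqrt d / ℓ * x i + v i⌋ : ℝ)

namespace RealRAM

/-- Instructions of a real random-access machine. There are natural-number registers (used for
counting and addressing), real registers, and a real memory addressed through the natural-number
registers. The first argument is the destination register, except in `store` and in the jumps;
the last argument `t` of a jump is the target line. Each instruction costs one step. -/
inductive Instr where
  | idxConst (i n : ℕ)
  | idxAdd (i j k : ℕ)
  | idxSub (i j k : ℕ)
  | const (a n : ℕ)
  | ofIdx (a i : ℕ)
  | add (a b c : ℕ)
  | sub (a b c : ℕ)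
  | mul (a b c : ℕ)
  | div (a b c : ℕ)
  | sqrt (a b : ℕ)
  | floor (a b : ℕ)
  | load (a i : ℕ)
  | store (i a : ℕ)
  | jump (t : ℕ)
  | jumpIdxLt (i j t : ℕ)
  | jumpLt (a b t : ℕ)

/-- A program is a finite list of instructions, numbered from `0`. -/
abbrev Program := List Instr

/-- A configuration: the line to be executed next, the natural-number registers, the real registers
and the real memory. -/
@[ext] structure Config where
  pc : ℕ
  idx : ℕ → ℕ
  reg : ℕ → ℝ
  mem : ℕ → ℝ

/-- The effect of one instruction. -/
noncomputable def Instr.exec (s : Config) : Instr → Config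
  | .idxConst i n => { s with pc := s.pc + 1, idx := Function.update s.idx i n }
  | .idxAdd i j k => { s with pc := s.pc + 1, idx := Function.update s.idx i (s.idx j + s.idx k) }
  | .idxSub i j k => { s with pc := s.pc + 1, idx := Function.update s.idx i (s.idx j - s.idx k) }
  | .const a n => { s with pc := s.pc + 1, reg := Function.update s.reg a (n : ℝ) }
  | .ofIdx a i => { s with pc := s.pc + 1, reg := Function.update s.reg a (s.idx i : ℝ) }
  | .add a b c => { s with pc := s.pc + 1, reg := Function.update s.reg a (s.reg b + s.reg c) }
  | .sub a b c => { s with pc := s.pc + 1, reg := Function.update s.reg a (s.reg b - s.reg c) }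
  | .mul a b c => { s with pc := s.pc + 1, reg := Function.update s.reg a (s.reg b * s.reg c) }
  | .div a b c => { s with pc := s.pc + 1, reg := Function.update s.reg a (s.reg b / s.reg c) }
  | .sqrt a b => { s with pc := s.pc + 1, reg := Function.update s.reg a (Real.sqrt (s.reg b)) }
  | .floor a b => { s with pc := s.pc + 1, reg := Function.update s.reg a (⌊s.reg b⌋ : ℝ) }
  | .load a i => { s with pc := s.pc + 1, reg := Function.update s.reg a (s.mem (s.idx i)) }
  | .store i a => { s with pc := s.pc + 1, mem := Function.update s.mem (s.idx i) (s.reg a) }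
  | .jump t => { s with pc := t }
  | .jumpIdxLt i j t => { s with pc := if s.idx i < s.idx j then t else s.pc + 1 }
  | .jumpLt a b t => { s with pc := open Classical in if s.reg a < s.reg b then t else s.pc + 1 }

/-- One step of a program; nothing happens once the line number has left the program. -/
noncomputable def step (prog : Program) (s : Config) : Config :=
  match prog[s.pc]? with
  | some instr => instr.exec s
  | none => s

/-- Started in `s`, the program `prog` halts after at most `T` steps, in the configuration `s'`. -/
def HaltsWithin (prog : Program) (T : ℕ) (s s' : Config) : Prop :=
  ∃ n ≤ T, (step prog)^[n] s = s' ∧ prog.length ≤ s'.pc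

/-- The initial configuration for evaluating a hash function of scale `ℓ` with random seed
`v ∈ ℝ^d` at the point `x ∈ ℝ^d`: `d` is in natural-number register `0`, `ℓ` in real register `0`,
`v` at the memory addresses `0, …, d - 1`, `x` at `d, …, 2d - 1`, and everything else is `0`. -/
noncomputable def initConfig (d : ℕ) (ℓ : ℝ) (v : Fin d → ℝ) (x : EuclideanSpace ℝ (Fin d)) :
    Config where
  pc := 0
  idx := fun i => if i = 0 then d else 0
  reg := fun a => if a = 0 then ℓ else 0
  mem := fun m =>
    if h : m < d then v ⟨m, h⟩ else if h' : m - d < d then x ⟨m - d, h'⟩ else 0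

/-- On `d`, `ℓ`, `v`, `x` the program halts after at most `T` steps with the vector `y ∈ ℝ^d` at the
memory addresses `2d, …, 3d - 1`. -/
def EvaluatesTo (prog : Program) (T d : ℕ) (ℓ : ℝ) (v : Fin d → ℝ)
    (x y : EuclideanSpace ℝ (Fin d)) : Prop :=
  ∃ s', HaltsWithin prog T (initConfig d ℓ v x) s' ∧ ∀ i : Fin d, s'.mem (2 * d + i) = y i

end RealRAM

/-! Averaging over the shift turns the expected number of cells met by a ball into a volume. Cell
`n` under shift `v` is cell `0` under shift `v - n`, and integer translates of the unit cube tile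
space, so the expectation is `volume (hitSet c R x)` (`lintegral_encard_gridHash_image`). Up to
reflection and translation, `hitSet` is the Minkowski sum of a unit cube and a ball of radius `c * R
= √d / β`. A Chernoff-type bound controls that volume: for any `b > 0` the indicator of `hitSet` is
at most `exp (b * (c * R) ^ 2)` times a product of one-variable functions, whose integral factors
over coordinates (`volume_hitSet_le`). Taking `b = β ^ (4/3)` gives an exponent of order `d / β ^
(2/3)`, with `p = 1`. -/

/-! ### Linear-time evaluation on the real RAM. -/

namespace RealRAM

/-- A do-while loop over the coordinates, after the grid density `√d / ℓ` has been put into real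
register `1`. -/
def gridProgram : Program :=
  [.idxConst 1 1, .idxAdd 3 0 2, .idxAdd 4 0 0, .ofIdx 1 0, .sqrt 1 1, .div 1 1 0,
   .load 2 3, .mul 2 1 2, .load 3 2, .add 2 2 3, .floor 2 2, .store 4 2,
   .idxAdd 2 2 1, .idxAdd 3 3 1, .idxAdd 4 4 1, .jumpIdxLt 2 0 6]

/-- The state of `gridProgram` after `k` rounds of its loop. -/
structure LoopInvariant (d : ℕ) (ℓ : ℝ) (v : Fin d → ℝ) (x : EuclideanSpace ℝ (Fin d)) (k : ℕ)
    (s : Config) : Prop where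
  -- The test comes at the end of the body, so the loop is entered at `k = 0` without any comparison
  -- with `d`.
  pc : s.pc = if k = 0 ∨ k < d then 6 else 16
  idx0 : s.idx 0 = d
  idx1 : s.idx 1 = 1
  idx2 : s.idx 2 = k
  idx3 : s.idx 3 = d + k
  idx4 : s.idx 4 = 2 * d + k
  reg1 : s.reg 1 = Real.sqrt d / ℓ
  seed : ∀ i : Fin d, s.mem i = v i
  point : ∀ i : Fin d, s.mem (d + i) = x i
  output : ∀ i : Fin d, (i : ℕ) < k → s.mem (2 * d + i) = gridHash d ℓ v x i

theorem loopInvariant_start (d : ℕ) (ℓ : ℝ) (v : Fin d → ℝ) (x : EuclideanSpace ℝ (Fin d)) :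
    LoopInvariant d ℓ v x 0 ((step gridProgram)^[6] (initConfig d ℓ v x)) := by
  constructor <;>
    simp [Function.iterate_succ, step, gridProgram, Instr.exec, initConfig, Function.update]
  all_goals omega

theorem LoopInvariant.iterate {d : ℕ} {ℓ : ℝ} {v : Fin d → ℝ} {x : EuclideanSpace ℝ (Fin d)}
    {k : ℕ} {s : Config} (h : LoopInvariant d ℓ v x k s) (hk : k < d) :
    LoopInvariant d ℓ v x (k + 1) ((step gridProgram)^[10] s) := by
  obtain ⟨hpc, h0, h1, h2, h3, h4, hr, hv, hx, ho⟩ := h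
  obtain ⟨pc, idx, reg, mem⟩ := s
  simp only [hk, or_true, if_true] at hpc h0 h1 h2 h3 h4 hr hv hx ho
  subst hpc
  have hvk := hv ⟨k, hk⟩
  have hxk := hx ⟨k, hk⟩
  simp only at hvk hxk
  constructor
  case output =>
    intro i hi
    rcases Nat.lt_succ_iff_lt_or_eq.mp hi with hi | hi
    · have := ho i hi
      have hne : (i : ℕ) ≠ k := hi.ne
      simp [Function.iterate_succ, step, gridProgram, Instr.exec, Function.update, h4, hne, this]
    · have hi' : i = ⟨k, hk⟩ := Fin.ext hi
      subst hi'
      simp [Function.iterate_succ, step, gridProgram, Instr.exec, Function.update, h4, h2, h3, hr,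
        hvk, hxk, gridHash]
  case seed =>
    intro i
    have hne : (i : ℕ) ≠ 2 * d + k := by omega
    simp [Function.iterate_succ, step, gridProgram, Instr.exec, Function.update, h4, hne, hv]
  case point =>
    intro i
    have hne : d + (i : ℕ) ≠ 2 * d + k := by omega
    simp [Function.iterate_succ, step, gridProgram, Instr.exec, Function.update, h4, hne, hx]
  all_goals
    simp [Function.iterate_succ, step, gridProgram, Instr.exec, Function.update, h0, h1, h2, h3,
      h4, hr]
  all_goals omega

theorem loopInvariant_iterate (d : ℕ) (ℓ : ℝ) (v : Fin d → ℝ) (x : EuclideanSpace ℝ (Fin d)) :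
    ∀ k ≤ d, LoopInvariant d ℓ v x k ((step gridProgram)^[10 * k + 6] (initConfig d ℓ v x))
  | 0, _ => loopInvariant_start d ℓ v x
  | k + 1, hk => by
    rw [show 10 * (k + 1) + 6 = 10 + (10 * k + 6) by ring, Function.iterate_add_apply]
    exact (loopInvariant_iterate d ℓ v x k (by omega)).iterate (by omega)

theorem gridProgram_evaluatesTo {d : ℕ} (hd : 1 ≤ d) (ℓ : ℝ) (v : Fin d → ℝ)
    (x : EuclideanSpace ℝ (Fin d)) :
    EvaluatesTo gridProgram (16 * d) d ℓ v x (gridHash d ℓ v x) := by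
  have h := loopInvariant_iterate d ℓ v x d le_rfl
  -- Six setup steps and ten per round; `1 ≤ d` absorbs the six into `16 * d`.
  refine ⟨_, ⟨10 * d + 6, by omega, rfl, ?_⟩, fun i => h.output i i.2⟩
  rw [h.pc, if_neg (by omega)]
  rfl

end RealRAM

/-! ### Unfolding over the integer lattice. -/

section Lattice

variable {ι : Type*} [Fintype ι]

theorem tsum_setLIntegral_unitCube_sub_intCast (F : (ι → ℝ) → ℝ≥0∞) :
    ∑' n : ι → ℤ, ∫⁻ v in Set.Icc (0 : ι → ℝ) 1, F (v - fun i => (n i : ℝ)) = ∫⁻ w, F w := by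
  set T : (ι → ℤ) → Set (ι → ℝ) := fun n => {w | ∀ i, ⌊w i⌋ = -n i} with hT
  have hmeas : ∀ n, MeasurableSet (T n) := fun n => by
    have : T n = ⋂ i, {w : ι → ℝ | ⌊w i⌋ = -n i} := by ext; simp [hT]
    rw [this]
    exact MeasurableSet.iInter fun i =>
      (Int.measurable_floor.comp (measurable_pi_apply i)) (measurableSet_singleton _)
  have hdisj : Pairwise (Function.onFun Disjoint T) := fun m n hmn =>
    Set.disjoint_left.mpr fun w hm hn => hmn <| funext fun i =>
      neg_injective ((hm i).symm.trans (hn i))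
  have hunion : ⋃ n, T n = Set.univ := Set.eq_univ_of_forall fun w =>
    Set.mem_iUnion.mpr ⟨fun i => -⌊w i⌋, fun i => by simp⟩
  rw [← setLIntegral_univ F, ← hunion, lintegral_iUnion hmeas hdisj]
  refine tsum_congr fun n => ?_
  have hpre : (fun v : ι → ℝ => v - fun i => (n i : ℝ)) ⁻¹' T n
      = Set.univ.pi fun i => Set.Ico ((0 : ι → ℝ) i) ((1 : ι → ℝ) i) := by
    ext v
    simp [hT, Int.floor_eq_iff]
  -- Half-open cubes tile exactly; the closed cube differs by a null set.
  have hbox : (Set.univ.pi fun i => Set.Ico ((0 : ι → ℝ) i) ((1 : ι → ℝ) i)) =ᵐ[volume]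
      Set.Icc (0 : ι → ℝ) 1 := Measure.univ_pi_Ico_ae_eq_Icc
  rw [← setLIntegral_congr hbox, ← hpre]
  exact (measurePreserving_sub_right volume (fun i => (n i : ℝ))).setLIntegral_comp_preimage_emb
    (MeasurableEquiv.subRight _).measurableEmbedding F (T n)

end Lattice

/-! ### Gaussian bound for the volume of a cube plus a ball. -/

/-- A function which dominates `exp (-b * (t - s) ^ 2)` for all `s` in the unit interval. -/
noncomputable def unitGaussian (b t : ℝ) : ℝ :=
  (Set.Icc (0 : ℝ) 1).indicator 1 t + (Real.exp (-b * t ^ 2) + Real.exp (-b * (t - 1) ^ 2))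

theorem unitGaussian_nonneg (b t : ℝ) : 0 ≤ unitGaussian b t :=
  add_nonneg (Set.indicator_nonneg (fun _ _ => zero_le_one) _) (by positivity)

/-- Inside the unit interval the indicator suffices; outside it, the worst `s` is the endpoint
nearest to `t`. -/
theorem exp_le_unitGaussian {b s : ℝ} (hb : 0 ≤ b) (hs : s ∈ Set.Icc (0 : ℝ) 1) (t : ℝ) :
    Real.exp (-b * (t - s) ^ 2) ≤ unitGaussian b t := by
  have h₀ := (Real.exp_pos (-b * t ^ 2)).le
  have h₁ := (Real.exp_pos (-b * (t - 1) ^ 2)).le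
  by_cases ht : t ∈ Set.Icc (0 : ℝ) 1
  · have : Real.exp (-b * (t - s) ^ 2) ≤ 1 :=
      Real.exp_le_one_iff.mpr (by nlinarith [mul_nonneg hb (sq_nonneg (t - s))])
    simp only [unitGaussian, Set.indicator_of_mem ht, Pi.one_apply]
    linarith
  · simp only [unitGaussian, Set.indicator_of_notMem ht, zero_add]
    obtain ⟨hs0, hs1⟩ := hs
    rcases lt_or_ge t 0 with h | h
    · have : Real.exp (-b * (t - s) ^ 2) ≤ Real.exp (-b * t ^ 2) :=
        Real.exp_le_exp.mpr <| mul_le_mul_of_nonpos_left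
          (by nlinarith [mul_nonneg (neg_pos.mpr h).le hs0]) (by linarith)
      linarith
    · have h1 : 1 < t := lt_of_not_ge fun h1 => ht ⟨h, h1⟩
      have : Real.exp (-b * (t - s) ^ 2) ≤ Real.exp (-b * (t - 1) ^ 2) :=
        Real.exp_le_exp.mpr <| mul_le_mul_of_nonpos_left (by nlinarith) (by linarith)
      linarith

theorem integrable_unitGaussian {b : ℝ} (hb : 0 < b) : Integrable (unitGaussian b) :=
  ((continuousOn_const.integrableOn_Icc).integrable_indicator measurableSet_Icc).add
    ((integrable_exp_neg_mul_sq hb).add ((integrable_exp_neg_mul_sq hb).comp_sub_right 1))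

theorem integral_unitGaussian {b : ℝ} (hb : 0 < b) :
    ∫ t, unitGaussian b t = 1 + 2 * Real.sqrt (Real.pi / b) := by
  have h₁ : Integrable ((Set.Icc (0 : ℝ) 1).indicator (1 : ℝ → ℝ)) :=
    (continuousOn_const.integrableOn_Icc).integrable_indicator measurableSet_Icc
  have h₂ := integrable_exp_neg_mul_sq hb
  have h₃ := h₂.comp_sub_right 1
  unfold unitGaussian
  have h₄ : Integrable fun t : ℝ => Real.exp (-b * t ^ 2) + Real.exp (-b * (t - 1) ^ 2) :=
    h₂.add h₃
  rw [integral_add h₁ h₄, integral_add h₂ h₃,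
    integral_sub_right_eq_self (fun t : ℝ => Real.exp (-b * t ^ 2)) 1, integral_gaussian,
    integral_indicator_one measurableSet_Icc]
  simp
  ring

/-- The shifts for which the grid with cells of side `1 / c` has its cell with coordinates `0`
met by the ball of radius `R` around `x`. -/
def hitSet {d : ℕ} (c R : ℝ) (x : EuclideanSpace ℝ (Fin d)) : Set (Fin d → ℝ) :=
  {w | ∃ z ∈ Metric.closedBall x R, ∀ i, c * z i + w i ∈ Set.Ico (0 : ℝ) 1}

variable {d : ℕ}

theorem convex_hitSet (c R : ℝ) (x : EuclideanSpace ℝ (Fin d)) : Convex ℝ (hitSet c R x) := by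
  rintro w₁ ⟨z₁, hz₁, h₁⟩ w₂ ⟨z₂, hz₂, h₂⟩ a b ha hb hab
  refine ⟨a • z₁ + b • z₂, convex_closedBall x R hz₁ hz₂ ha hb hab, fun i => ?_⟩
  have := convex_Ico (𝕜 := ℝ) (0 : ℝ) 1 (h₁ i) (h₂ i) ha hb hab
  convert this using 1
  simp
  ring

/-- Convexity replaces a direct measurability argument for this projection-type set. -/
theorem nullMeasurableSet_hitSet (c R : ℝ) (x : EuclideanSpace ℝ (Fin d)) :
    NullMeasurableSet (hitSet c R x) volume :=
  (convex_hitSet c R x).nullMeasurableSet volume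

/-- A witness `z` splits `w + c * x` into a point of the unit cube and a remainder of norm at most
`c * R`; the exponential prefactor pays for the Gaussian weight of the remainder. -/
theorem one_le_of_mem_hitSet {c b R : ℝ} (hb : 0 ≤ b) (x : EuclideanSpace ℝ (Fin d))
    {w : Fin d → ℝ} (hw : w ∈ hitSet c R x) :
    1 ≤ Real.exp (b * (c * R) ^ 2) * ∏ i, unitGaussian b (w i + c * x i) := by
  obtain ⟨z, hz, h⟩ := hw
  have hdist : ∑ i, (c * (x i - z i)) ^ 2 ≤ (c * R) ^ 2 := by
    have h₁ : dist z x ^ 2 ≤ R ^ 2 := pow_le_pow_left₀ dist_nonneg hz 2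
    rw [EuclideanSpace.dist_eq, Real.sq_sqrt (by positivity)] at h₁
    calc ∑ i, (c * (x i - z i)) ^ 2 = c ^ 2 * ∑ i, dist (z i) (x i) ^ 2 := by
          rw [Finset.mul_sum]
          refine Finset.sum_congr rfl fun i _ => ?_
          rw [Real.dist_eq, sq_abs]
          ring
      _ ≤ (c * R) ^ 2 := by
          rw [mul_pow]
          exact mul_le_mul_of_nonneg_left h₁ (sq_nonneg c)
  calc (1 : ℝ) ≤ Real.exp (b * (c * R) ^ 2) * Real.exp (∑ i, -b * (c * (x i - z i)) ^ 2) := by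
        rw [← Real.exp_add, Real.one_le_exp_iff, ← Finset.mul_sum]
        nlinarith
    _ ≤ _ := by
        rw [Real.exp_sum]
        gcongr with i
        rw [show c * (x i - z i) = w i + c * x i - (c * z i + w i) by ring]
        exact exp_le_unitGaussian hb (Set.Ico_subset_Icc_self (h i)) (w i + c * x i)

theorem volume_hitSet_le {c b : ℝ} (hb : 0 < b) (R : ℝ) (x : EuclideanSpace ℝ (Fin d)) :
    volume (hitSet c R x) ≤
      ENNReal.ofReal (Real.exp (b * (c * R) ^ 2) * (1 + 2 * Real.sqrt (Real.pi / b)) ^ d) := by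
  set G : (Fin d → ℝ) → ℝ := fun w =>
    Real.exp (b * (c * R) ^ 2) * ∏ i, unitGaussian b (w i + c * x i)
  have hG : Integrable G := (Integrable.fintype_prod
    (f := fun i t => unitGaussian b (t + c * x i))
    (fun i => (integrable_unitGaussian hb).comp_add_right (c * x i))).const_mul _
  have hG0 : ∀ w, 0 ≤ G w := fun w =>
    mul_nonneg (Real.exp_pos _).le (Finset.prod_nonneg fun i _ => unitGaussian_nonneg _ _)
  have hint : ∫ w, G w = Real.exp (b * (c * R) ^ 2) * (1 + 2 * Real.sqrt (Real.pi / b)) ^ d := by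
    rw [integral_const_mul,
      integral_fintype_prod_volume_eq_prod (fun i t => unitGaussian b (t + c * x i))]
    simp [integral_add_right_eq_self (unitGaussian b), integral_unitGaussian hb]
  rw [← lintegral_indicator_one₀ (nullMeasurableSet_hitSet c R x), ← hint,
    ofReal_integral_eq_lintegral_ofReal hG (.of_forall hG0)]
  refine lintegral_mono fun w => ?_
  by_cases hw : w ∈ hitSet c R x
  · simpa [Set.indicator_of_mem hw] using one_le_of_mem_hitSet hb.le x hw
  · simp [Set.indicator_of_notMem hw]

/-! ### The grid as a consistent hashing. -/

theorem encard_gridHash_image (ℓ R : ℝ) (v : Fin d → ℝ) (x : EuclideanSpace ℝ (Fin d)) :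
    ((gridHash d ℓ v '' Metric.closedBall x R).encard : ℝ≥0∞) =
      ∑' n : Fin d → ℤ,
        (hitSet (Real.sqrt d / ℓ) R x).indicator 1 (v - fun i => (n i : ℝ)) := by
  set N : Set (Fin d → ℤ) := {n | (v - fun i => (n i : ℝ)) ∈ hitSet (Real.sqrt d / ℓ) R x}
  have himage : gridHash d ℓ v '' Metric.closedBall x R =
      (fun n : Fin d → ℤ => WithLp.toLp 2 fun i => (n i : ℝ)) '' N := by
    ext y
    constructor
    · rintro ⟨z, hz, rfl⟩
      refine ⟨fun i => ⌊Real.sqrt d / ℓ * z i + v i⌋, ⟨z, hz, fun i => ?_⟩, rfl⟩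
      have h₁ := Int.floor_le (Real.sqrt d / ℓ * z i + v i)
      have h₂ := Int.lt_floor_add_one (Real.sqrt d / ℓ * z i + v i)
      simp only [Pi.sub_apply]
      constructor <;> linarith
    · rintro ⟨n, ⟨z, hz, h⟩, rfl⟩
      refine ⟨z, hz, ?_⟩
      simp only [gridHash]
      congr 1
      ext i
      obtain ⟨h₁, h₂⟩ := h i
      simp only [Pi.sub_apply] at h₁ h₂
      exact congrArg Int.cast (Int.floor_eq_iff.mpr ⟨by linarith, by linarith⟩)
  have hinj : Function.Injective
      (fun n : Fin d → ℤ => (WithLp.toLp 2 fun i => (n i : ℝ) : EuclideanSpace ℝ (Fin d))) :=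
    fun m n h => funext fun i => by simpa using congrArg (fun y => y.ofLp i) h
  rw [himage, hinj.injOn.encard_image, ← ENNReal.tsum_set_one, tsum_subtype N fun _ => 1]
  rfl

theorem aemeasurable_indicator_hitSet (c R : ℝ) (x : EuclideanSpace ℝ (Fin d)) (n : Fin d → ℤ) :
    AEMeasurable (fun v => (hitSet c R x).indicator (1 : (Fin d → ℝ) → ℝ≥0∞) (v - fun i => (n i : ℝ)))
      (uniformCube d) := by
  have h : AEMeasurable ((hitSet c R x).indicator (1 : (Fin d → ℝ) → ℝ≥0∞)) volume :=
    aemeasurable_one.indicator₀ (nullMeasurableSet_hitSet c R x)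
  exact (h.comp_quasiMeasurePreserving
    (measurePreserving_sub_right volume _).quasiMeasurePreserving).restrict

theorem lintegral_encard_gridHash_image (ℓ R : ℝ) (x : EuclideanSpace ℝ (Fin d)) :
    ∫⁻ v, ((gridHash d ℓ v '' Metric.closedBall x R).encard : ℝ≥0∞) ∂uniformCube d =
      volume (hitSet (Real.sqrt d / ℓ) R x) := by
  simp_rw [encard_gridHash_image]
  rw [lintegral_tsum fun n => aemeasurable_indicator_hitSet _ R x n,
    ← lintegral_indicator_one₀ (nullMeasurableSet_hitSet _ R x)]
  exact tsum_setLIntegral_unitCube_sub_intCast _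

theorem measurable_gridHash (ℓ : ℝ) (x : EuclideanSpace ℝ (Fin d)) :
    Measurable fun v => gridHash d ℓ v x := by
  refine (WithLp.measurable_toLp 2 _).comp (measurable_pi_lambda _ fun i => ?_)
  exact (measurable_of_countable (Int.cast : ℤ → ℝ)).comp
    (Int.measurable_floor.comp (measurable_const.add (measurable_pi_apply i)))

theorem dist_le_of_gridHash_eq (hd : 1 ≤ d) {ℓ : ℝ} (hℓ : 0 < ℓ) {v : Fin d → ℝ}
    {y z : EuclideanSpace ℝ (Fin d)} (h : gridHash d ℓ v y = gridHash d ℓ v z) :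
    dist y z ≤ ℓ := by
  have hd' : (0 : ℝ) < d := by exact_mod_cast hd
  have hcoord : ∀ i, dist (y i) (z i) ^ 2 ≤ ℓ ^ 2 / d := fun i => by
    have hi : ⌊Real.sqrt d / ℓ * y i + v i⌋ = ⌊Real.sqrt d / ℓ * z i + v i⌋ := by
      have := congrArg (fun u => u.ofLp i) h
      simpa [gridHash] using this
    have hlt := Int.abs_sub_lt_one_of_floor_eq_floor hi
    have hsq : (Real.sqrt d / ℓ * (y i - z i)) ^ 2 ≤ 1 := by
      rw [sq_le_one_iff_abs_le_one]
      convert hlt.le using 2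
      ring
    rw [mul_pow, div_pow, Real.sq_sqrt hd'.le] at hsq
    rw [Real.dist_eq, sq_abs, le_div_iff₀ hd']
    rw [div_mul_eq_mul_div, div_le_one (by positivity)] at hsq
    linarith
  rw [EuclideanSpace.dist_eq]
  refine Real.sqrt_le_iff.mpr ⟨hℓ.le, (Finset.sum_le_sum fun i _ => hcoord i).trans ?_⟩
  simp only [Finset.sum_const, Finset.card_univ, Fintype.card_fin, nsmul_eq_mul]
  rw [mul_div_cancel₀ _ hd'.ne']

theorem isConsistentHashing_gridHash (hd : 1 ≤ d) {β ℓ : ℝ} (hβ : 0 < β) (hℓ : 0 < ℓ) :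
    IsConsistentHashing β
      (Real.exp ((1 + 2 * Real.sqrt Real.pi) * ((d : ℝ) / β ^ (2 / 3 : ℝ)))) ℓ
      (uniformCube d) (gridHash d ℓ) where
  isProbabilityMeasure := ⟨by simp [uniformCube, Real.volume_Icc_pi]⟩
  measurable_eval := measurable_gridHash ℓ
  diameter v x := Metric.ediam_le fun y hy z hz => by
    rw [edist_dist]
    exact ENNReal.ofReal_le_ofReal (dist_le_of_gridHash_eq hd hℓ (hy.trans hz.symm))
  aemeasurable_card x := by
    simp_rw [encard_gridHash_image]
    exact AEMeasurable.tsum fun n => aemeasurable_indicator_hitSet _ _ x n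
  consistency x := by
    rw [lintegral_encard_gridHash_image]
    set q := β ^ (2 / 3 : ℝ) with hq
    have hq0 : 0 < q := Real.rpow_pos_of_pos hβ _
    have hq3 : q ^ 3 = β ^ 2 := by
      rw [hq, ← Real.rpow_natCast, ← Real.rpow_mul hβ.le]
      norm_num
    -- The choice `b = q ^ 2` balances the costs `b * d / β ^ 2` and `d / √b`: both become `d / q`,
    -- since `q ^ 3 = β ^ 2`.
    refine (volume_hitSet_le (pow_pos hq0 2) _ x).trans (ENNReal.ofReal_le_ofReal ?_)
    have hexp : q ^ 2 * (Real.sqrt d / ℓ * (ℓ / β)) ^ 2 = d / q := by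
      rw [div_mul_div_cancel₀ hℓ.ne', div_pow, Real.sq_sqrt d.cast_nonneg, ← hq3]
      field_simp
    have hsqrt : Real.sqrt (Real.pi / q ^ 2) = Real.sqrt Real.pi / q := by
      rw [Real.sqrt_div Real.pi_pos.le, Real.sqrt_sq hq0.le]
    rw [hexp, hsqrt]
    calc Real.exp (d / q) * (1 + 2 * (Real.sqrt Real.pi / q)) ^ d
        ≤ Real.exp (d / q) * Real.exp (2 * (Real.sqrt Real.pi / q)) ^ d := by
          gcongr
          rw [add_comm]
          exact Real.add_one_le_exp _
      _ = Real.exp ((1 + 2 * Real.sqrt Real.pi) * (d / q)) := by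
          rw [← Real.exp_nat_mul, ← Real.exp_add]
          congr 1
          ring

theorem mainTheorem3 :
    ∃ (p : Polynomial ℝ) (K : ℝ) (C : ℕ) (prog : RealRAM.Program),
      ∀ (d : ℕ), 1 ≤ d → ∀ (β : ℝ), Real.sqrt (2 * Real.pi) ≤ β → ∀ (ℓ : ℝ), 0 < ℓ →
        IsConsistentHashing β
            (p.eval (d : ℝ) * Real.exp (K * ((d : ℝ) / β ^ (2 / 3 : ℝ)))) ℓ
            (uniformCube d) (gridHash d ℓ) ∧
          ∀ (v : Fin d → ℝ) (x : EuclideanSpace ℝ (Fin d)),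
            RealRAM.EvaluatesTo prog (C * d) d ℓ v x (gridHash d ℓ v x) := by
  refine ⟨1, 1 + 2 * Real.sqrt Real.pi, 16, RealRAM.gridProgram, fun d hd β hβ ℓ hℓ =>
    ⟨?_, fun v x => RealRAM.gridProgram_evaluatesTo hd ℓ v x⟩⟩
  rw [Polynomial.eval_one, one_mul]
  exact isConsistentHashing_gridHash hd (lt_of_lt_of_le (by positivity) hβ) hℓ
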